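/- **Setting.** Let $\mathcal M$ be a linear structural causal model on the feature vector $v=(a,x)\in\mathbb R^n$ with sensitive part $a$ and non-sensitive part $x$: $V_i=\sum_j B_{ij}V_j+U_i$ with acyclic causal graph (no relation between the causal order and the sensitive/non-sensitive splitting is assumed). Write $F$ for the reduced-form map $u\mapsto v$, and $P_{\mathcal A},P_{\mathcal X}$ for the coordinate projections onto the sensitive and non-sensitive parts. Let $g(v)$ be the vector obtained from $v$ by keeping the sensitive coordinates and replacing the non-sensitive ones by the corresponding exogenous variables $(v-Bv)_i$; $g$ is linear and bijective, and $M$ is the matrix of $g^{-1}$. The sensitive attributes range over a set $\mathcal A$, the non-sensitive ones are unrestricted, so $\mathcal V=\{v: P_{\mathcal A}v\in\mathcal A\}$; labels lie in $\mathcal Y\subseteq\mathbb R$, and $\mathcal Z=\mathcal V\times\mathcal Y$. The twin of $v$ at level $a\in\mathcal A$ is the hard-intervention counterfactual $\ddot v_a=F^{do(\mathbf A:=a)}(F^{-1}(v))$. Let $\|\cdot\|$ be any norm on the non-sensitive coordinates, $\|x\|_*=\sup\{x^Tx':\|x'\|\le1\}$ its dual, $d(v,v')=\|P_{\mathcal X}(g(v))-P_{\mathcal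 X}(g(v'))\|$, and let the transport cost be $c((v,y),(v',y'))=d(v,v')+\infty\cdot|y-y'|$. For $\delta\ge0$ let $\mathbb B_\delta(\mathbb P)$ be the set of probability measures $\mathbb Q$ on $\mathcal Z$ with $W_{c,1}(\mathbb P,\mathbb Q)\le\delta$, where $W_{c,1}(\mathbb P,\mathbb Q)=\inf_\pi \mathbb E_\pi[c]$ over couplings $\pi$ of $\mathbb P$ and $\mathbb Q$. For a loss $\ell$ put $$\mathcal R(\mathbb P,\theta)=\mathbb E_{\mathbb P}[\ell(Z,\theta)],\quad \mathcal R^{cf}(\mathbb P,\theta)=\mathbb E_{\mathbb P}\Big[\sup_{a\in\mathcal A}\ell(\ddot v_a,y,\theta)\Big],\quad \mathcal R_\delta(\mathbb P,\theta)=\sup_{\mathbb Q\in\mathbb B_\delta(\mathbb P)}\mathbb E_{\mathbb Q}[\ell(Z,\theta)],$$ with expectations in $[-\infty,\infty]$ (and $\infty-\infty=-\infty$). Let $\mathbb P_N=\frac1N\sum_{i=1}^N\delta_{z^i}$ be the empirical distribution of $N\ge1$ observations $z^i\in\mathcal Z$. **Theorem 3 (Nonlinear Loss).** Let $\theta\in\mathbb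 R^n$ and let $\ell(z,\theta)$ be either $h(y-\langle\theta,v\rangle)$ (regression), or $h(y\cdot\langle\theta,v\rangle)$ with $\mathcal Y\subseteq\{-1,1\}$ (classification), where $h:\mathbb R\to\mathbb R$ satisfies (i) $|h(t_2)-h(t_1)|\le L_h|t_2-t_1|$ for all $t_1,t_2\in\mathbb R$; (ii) there is a sequence $(t_k)$ with $|t_k|\to\infty$ such that $\displaystyle\lim_{k\to\infty}\frac{h(t_0+t_k)-h(t_0)}{|t_k|}=L_h$ for every $t_0\in\mathbb R$. Then: * if $\operatorname{diam}\mathcal A<\infty$, then $\mathcal R_\delta(\mathbb P_N,\theta)=\mathcal R^{cf}(\mathbb P_N,\theta)+\delta L_h\|P_{\mathcal X}(M^T\theta)\|_*$; * if $\operatorname{diam}\mathcal A=\infty$ and $P_{\mathcal A}(M^T\theta)=0$, then $\mathcal R_\delta(\mathbb P_N,\theta)=\mathcal R(\mathbb P_N,\theta)+\delta L_h\|P_{\mathcal X}(M^T\theta)\|_*$; * if $\operatorname{diam}\mathcal A=\infty$ and $P_{\mathcal A}(M^T\theta)\ne0$, if moreover $L_h>0$ and every vector of sensitive values is within some fixed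 distance $r$ of $\mathcal A$ (for instance, $\mathcal A$ is the whole space or the integer lattice), then $\mathcal R_\delta(\mathbb P_N,\theta)=+\infty$; that is, the constraint $P_{\mathcal A}(M^T\theta)=0$ is then necessary for a finite worst-case loss. -/

import Mathlib

open MeasureTheory
open scoped Matrix ENNReal

noncomputable section

/-- A linear structural causal model with endogenous variables indexed by `ι`: the structural
equations are `V i := ∑ j, coeff i j * V j + U i`, and the causal graph (an edge `j ⟶ i` whenever
`coeff i j ≠ 0`) is acyclic, i.e. it admits a topological ordering. -/
structure LinearSCM (ι : Type*) [Fintype ι] where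
  /-- The coefficients of the structural equations. -/
  coeff : Matrix ι ι ℝ
  /-- Parents come strictly before their children in some ordering of the variables. -/
  acyclic : ∃ rank : ι → ℕ, ∀ i j, coeff i j ≠ 0 → rank j < rank i

namespace LinearSCM

section General

variable {ι : Type*} [Fintype ι] [DecidableEq ι]

/-- The exogenous vector `F⁻¹(v) = (I - f)(v)` that produces the features `v`. -/
def exogenous (S : LinearSCM ι) (v : ι → ℝ) : ι → ℝ := v - S.coeff *ᵥ v

/-- The matrix of the reduced-form map `F = (I - f)⁻¹`. -/
def reducedForm (S : LinearSCM ι) : Matrix ι ι ℝ := (1 - S.coeff)⁻¹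

/-- By acyclicity, `I - f` is invertible, so the inverse in `reducedForm` is a genuine inverse. -/
theorem isUnit_det (S : LinearSCM ι) : IsUnit (1 - S.coeff).det := by
  obtain ⟨rank, hrank⟩ := S.acyclic
  rw [← Matrix.isUnit_iff_isUnit_det, ← Matrix.mulVec_injective_iff_isUnit]
  intro x y hxy
  have key : ∀ n : ℕ, ∀ i, rank i = n → x i = y i := by
    intro n
    induction n using Nat.strong_induction_on with
    | _ n ih =>
      intro i hi
      have h := congrFun hxy i
      simp only [Matrix.sub_mulVec, Matrix.one_mulVec, Pi.sub_apply] at h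
      have hs : (S.coeff *ᵥ x) i = (S.coeff *ᵥ y) i := by
        simp only [Matrix.mulVec, dotProduct]
        refine Finset.sum_congr rfl fun j _ => ?_
        by_cases hj : S.coeff i j = 0
        · simp [hj]
        · rw [ih (rank j) (hi ▸ hrank i j hj) j rfl]
      linarith
  exact funext fun i => key _ i rfl

/-- `F(u)` solves the structural equations with exogenous vector `u`. -/
theorem reducedForm_spec (S : LinearSCM ι) (u : ι → ℝ) (i : ι) :
    (S.reducedForm *ᵥ u) i = ∑ j, S.coeff i j * (S.reducedForm *ᵥ u) j + u i := by
  have h : (1 - S.coeff) *ᵥ (S.reducedForm *ᵥ u) = u := by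
    rw [Matrix.mulVec_mulVec, reducedForm, Matrix.mul_nonsing_inv _ S.isUnit_det,
      Matrix.one_mulVec]
  have h' := congrFun h i
  simp only [Matrix.sub_mulVec, Matrix.one_mulVec, Pi.sub_apply] at h'
  have e : (S.coeff *ᵥ (S.reducedForm *ᵥ u)) i
      = ∑ j, S.coeff i j * (S.reducedForm *ᵥ u) j := rfl
  linarith

end General

/-! The features are `v = (a, x)`: the sensitive attributes are indexed by `α` and the non-sensitive
ones by `χ`. No relation between this splitting and the causal order is assumed. -/

variable {α χ : Type*} [Fintype α] [Fintype χ] [DecidableEq α] [DecidableEq χ]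

/-- The parent-free sensitive attribute model: the structural equations of the sensitive attributes
are replaced by `V i := U i`, all the others are kept. -/
def parentFree (S : LinearSCM (α ⊕ χ)) : LinearSCM (α ⊕ χ) where
  coeff := Matrix.of fun i j => Sum.elim (fun _ => 0) (fun k => S.coeff (Sum.inr k) j) i
  acyclic := by
    obtain ⟨rank, hrank⟩ := S.acyclic
    refine ⟨rank, fun i j h => ?_⟩
    rcases i with i | i
    · simp at h
    · exact hrank _ _ (by simpa using h)

/-- The map `g` to the semi-latent space: sensitive coordinates are kept, the non-sensitive
coordinates of `v` are replaced by the corresponding exogenous variables. -/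
def semiLatent (S : LinearSCM (α ⊕ χ)) (v : α ⊕ χ → ℝ) : α ⊕ χ → ℝ :=
  Sum.elim (fun i => v (Sum.inl i)) (fun k => S.exogenous v (Sum.inr k))

/-- The matrix `M` of the linear map `g⁻¹`. -/
def semiLatentInv (S : LinearSCM (α ⊕ χ)) : Matrix (α ⊕ χ) (α ⊕ χ) ℝ := S.parentFree.reducedForm

/-- `g v = (1 - B₀) v`, where `B₀` holds the coefficients of the parent-free model. -/
theorem semiLatent_eq (S : LinearSCM (α ⊕ χ)) (v : α ⊕ χ → ℝ) :
    S.semiLatent v = (1 - S.parentFree.coeff) *ᵥ v := by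
  rw [Matrix.sub_mulVec, Matrix.one_mulVec]
  funext i
  rcases i with i | i <;>
    simp [semiLatent, exogenous, parentFree, Matrix.mulVec, dotProduct]

/-- `M` inverts `g` on the right. -/
theorem semiLatent_semiLatentInv (S : LinearSCM (α ⊕ χ)) (u : α ⊕ χ → ℝ) :
    S.semiLatent (S.semiLatentInv *ᵥ u) = u := by
  rw [semiLatent_eq, Matrix.mulVec_mulVec, semiLatentInv, reducedForm,
    Matrix.mul_nonsing_inv _ S.parentFree.isUnit_det, Matrix.one_mulVec]

/-- `M` inverts `g` on the left. -/
theorem semiLatentInv_semiLatent (S : LinearSCM (α ⊕ χ)) (v : α ⊕ χ → ℝ) :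
    S.semiLatentInv *ᵥ S.semiLatent v = v := by
  rw [semiLatent_eq, Matrix.mulVec_mulVec, semiLatentInv, reducedForm,
    Matrix.nonsing_inv_mul _ S.parentFree.isUnit_det, Matrix.one_mulVec]

/-- The reduced form `F^{do(A := a)}` of the hard intervention on all sensitive attributes. The
intervened structural equations are `V i := a i` for sensitive `i`, and unchanged otherwise. -/
def doSensitive (S : LinearSCM (α ⊕ χ)) (a : α → ℝ) (u : α ⊕ χ → ℝ) : α ⊕ χ → ℝ :=
  S.parentFree.reducedForm *ᵥ Sum.elim a (fun k => u (Sum.inr k))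

/-- The intervened structural equation of a sensitive attribute. -/
theorem doSensitive_inl (S : LinearSCM (α ⊕ χ)) (a : α → ℝ) (u : α ⊕ χ → ℝ) (i : α) :
    S.doSensitive a u (Sum.inl i) = a i := by
  rw [doSensitive, reducedForm_spec]
  simp [parentFree]

/-- The intervened structural equation of a non-sensitive attribute. -/
theorem doSensitive_inr (S : LinearSCM (α ⊕ χ)) (a : α → ℝ) (u : α ⊕ χ → ℝ) (k : χ) :
    S.doSensitive a u (Sum.inr k)
      = ∑ j, S.coeff (Sum.inr k) j * S.doSensitive a u j + u (Sum.inr k) := by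
  conv_lhs => rw [doSensitive, reducedForm_spec]
  rfl

/-- The counterfactual twin `CF(v, a) = F^{do(A := a)}(F⁻¹(v))`. -/
def twin (S : LinearSCM (α ⊕ χ)) (v : α ⊕ χ → ℝ) (a : α → ℝ) : α ⊕ χ → ℝ :=
  S.doSensitive a (S.exogenous v)

end LinearSCM

section DRO

variable {α χ : Type*}

/-- Projection to the sensitive part. -/
def projA (u : α ⊕ χ → ℝ) : α → ℝ := fun i => u (Sum.inl i)

/-- Projection to the non-sensitive part. -/
def projX (u : α ⊕ χ → ℝ) : χ → ℝ := fun k => u (Sum.inr k)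

/-- The feature space: the sensitive part ranges over `𝒜`, the non-sensitive part is
unrestricted. -/
abbrev FeatureSpace (χ : Type*) (𝒜 : Set (α → ℝ)) : Type _ :=
  {v : α ⊕ χ → ℝ // projA v ∈ 𝒜}

/-- The observation space `𝒵 = 𝒱 × 𝒴`. -/
abbrev ObsSpace (χ : Type*) (𝒜 : Set (α → ℝ)) (𝒴 : Set ℝ) : Type _ :=
  FeatureSpace χ 𝒜 × 𝒴

/-- The dual norm `sup {⟨x, x'⟩ : ‖x'‖ ≤ 1}` of a norm on `χ → ℝ`. -/
def dualNorm [Fintype χ] (nrm : Seminorm ℝ (χ → ℝ)) (x : χ → ℝ) : ℝ :=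
  sSup {r : ℝ | ∃ x' : χ → ℝ, nrm x' ≤ 1 ∧ r = x ⬝ᵥ x'}

/-- The causally fair dissimilarity function `d(v, v') = ‖P_X(g(v)) - P_X(g(v'))‖`. -/
def cfdf [Fintype α] [Fintype χ] [DecidableEq α] [DecidableEq χ]
    (S : LinearSCM (α ⊕ χ)) (nrm : Seminorm ℝ (χ → ℝ)) (v v' : α ⊕ χ → ℝ) : ℝ :=
  nrm (projX (S.semiLatent v) - projX (S.semiLatent v'))

/-- The transport cost `c((v, y), (v', y')) = d(v, v') + ∞ * |y - y'|`, with `∞ * 0 = 0`. -/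
def transportCost [Fintype α] [Fintype χ] [DecidableEq α] [DecidableEq χ]
    (S : LinearSCM (α ⊕ χ)) (nrm : Seminorm ℝ (χ → ℝ)) {𝒜 : Set (α → ℝ)} {𝒴 : Set ℝ}
    (z z' : ObsSpace χ 𝒜 𝒴) : ℝ≥0∞ :=
  ENNReal.ofReal (cfdf S nrm z.1.1 z'.1.1) + ⊤ * ENNReal.ofReal |(z.2 : ℝ) - z'.2|

/-- The optimal transport cost
`W_{c,p}(P, Q) = (inf {E_π[c ^ p] : π a coupling of P and Q}) ^ (1 / p)`. -/
def otCost {Z : Type*} [MeasurableSpace Z] (c : Z → Z → ℝ≥0∞) (p : ℝ) (P Q : Measure Z) : ℝ≥0∞ :=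
  (⨅ (π : Measure (Z × Z)) (_ : π.map Prod.fst = P ∧ π.map Prod.snd = Q),
    ∫⁻ w, c w.1 w.2 ^ p ∂π) ^ (1 / p)

/-- The ambiguity set: all probability measures within transport cost `δ` of `P`. -/
def ambiguitySet {Z : Type*} [MeasurableSpace Z] (c : Z → Z → ℝ≥0∞) (p δ : ℝ) (P : Measure Z) :
    Set (Measure Z) :=
  {Q | IsProbabilityMeasure Q ∧ otCost c p P Q ≤ ENNReal.ofReal δ}

/-- The expectation `E_P[f] = E_P[f⁺] - E_P[f⁻]` of an extended-real function, with the convention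
that it is `-∞` when both terms are infinite. -/
def eExp {Z : Type*} [MeasurableSpace Z] (P : Measure Z) (f : Z → EReal) : EReal :=
  ((∫⁻ z, (f z).toENNReal ∂P : ℝ≥0∞) : EReal) - ((∫⁻ z, (-f z).toENNReal ∂P : ℝ≥0∞) : EReal)

/-- The empirical distribution `(1 / N) ∑ i, δ_{z i}`. -/
def empirical {Z : Type*} [MeasurableSpace Z] {N : ℕ} (z : Fin N → Z) : Measure Z :=
  (N : ℝ≥0∞)⁻¹ • ∑ i, Measure.dirac (z i)

/-- The risk `R(P, θ) = E_P[ℓ(Z, θ)]`; the loss `ℓ v y` is taken at a fixed parameter `θ`. -/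
def risk {𝒜 : Set (α → ℝ)} {𝒴 : Set ℝ} (ℓ : (α ⊕ χ → ℝ) → ℝ → ℝ)
    (P : Measure (ObsSpace χ 𝒜 𝒴)) : EReal :=
  eExp P fun z => (ℓ z.1.1 z.2 : EReal)

/-- The counterfactual risk `R^cf(P, θ) = E_P[sup_{a ∈ 𝒜} ℓ(CF(v, a), y, θ)]`. -/
def cfRisk [Fintype α] [Fintype χ] [DecidableEq α] [DecidableEq χ] (S : LinearSCM (α ⊕ χ))
    {𝒜 : Set (α → ℝ)} {𝒴 : Set ℝ} (ℓ : (α ⊕ χ → ℝ) → ℝ → ℝ)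
    (P : Measure (ObsSpace χ 𝒜 𝒴)) : EReal :=
  eExp P fun z => ⨆ a ∈ 𝒜, (ℓ (S.twin z.1.1 a) z.2 : EReal)

/-- The worst-case loss `R_δ(P, θ) = sup {E_Q[ℓ(Z, θ)] : Q in the ambiguity set of P}`. -/
def worstRisk [Fintype α] [Fintype χ] [DecidableEq α] [DecidableEq χ] (S : LinearSCM (α ⊕ χ))
    (nrm : Seminorm ℝ (χ → ℝ)) (p δ : ℝ) {𝒜 : Set (α → ℝ)} {𝒴 : Set ℝ}
    (ℓ : (α ⊕ χ → ℝ) → ℝ → ℝ) (P : Measure (ObsSpace χ 𝒜 𝒴)) : EReal :=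
  ⨆ Q ∈ ambiguitySet (transportCost S nrm) p δ P, risk ℓ Q

/-- The regression loss `h(y - ⟨θ, v⟩)`. -/
def regressionLoss [Fintype α] [Fintype χ] (h : ℝ → ℝ) (θ : α ⊕ χ → ℝ) :
    (α ⊕ χ → ℝ) → ℝ → ℝ :=
  fun v y => h (y - θ ⬝ᵥ v)

/-- The classification loss `h(y * ⟨θ, v⟩)`. -/
def classificationLoss [Fintype α] [Fintype χ] (h : ℝ → ℝ) (θ : α ⊕ χ → ℝ) :
    (α ⊕ χ → ℝ) → ℝ → ℝ :=
  fun v y => h (y * (θ ⬝ᵥ v))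

end DRO

end

/-! In semi-latent coordinates the score splits as `θ ⬝ᵥ v = p ⬝ᵥ a + q ⬝ᵥ x`, with `p`, `q` the two
parts of `Mᵀθ` and `x` the non-sensitive part of `g v`. A twin changes only `a`; the cost sees only
`x` and forbids changing the label. Hence sensitive values move for free.

Upper bound (`eExp_le_of_otCost_le`): passing from `z` to `z'` through the twin of `z` at the level
of `z'` raises the loss above its supremum over twins by at most `L‖q‖_*` times the cost; integrate
over a nearly optimal coupling.

Lower bound (`twin_add_le_worstRisk`): send the atoms to nearly worst twins for free, then spend the
whole budget `δ` on a vanishing fraction of the mass, moved so far that `h` grows at its extreme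
slope `L`.

For bounded `𝒜` the supremum over twins is finite; for `p = 0` it is the loss itself; both are cases
of `worstRisk_eq_of_isLUB`. If `p ≠ 0` and `𝒜` is coarsely dense, free moves alone make the loss
arbitrarily large. -/

theorem EReal.coe_le_of_forall_pos {f : ℝ → ℝ} (hf : Continuous f) {W : EReal}
    (hW : ∀ ε > 0, (f ε : EReal) ≤ W) : (f 0 : EReal) ≤ W := by
  have h : Filter.Tendsto (fun ε => (f ε : EReal)) (nhdsWithin 0 (Set.Ioi 0)) (nhds (f 0)) :=
    ((continuous_coe_real_ereal.comp hf).tendsto 0).mono_left nhdsWithin_le_nhds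
  exact le_of_tendsto h (Filter.eventually_of_mem self_mem_nhdsWithin hW)

theorem EReal.le_coe_of_forall_pos {f : ℝ → ℝ} (hf : Continuous f) {W : EReal}
    (hW : ∀ ε > 0, W ≤ (f ε : EReal)) : W ≤ (f 0 : EReal) := by
  have h : Filter.Tendsto (fun ε => (f ε : EReal)) (nhdsWithin 0 (Set.Ioi 0)) (nhds (f 0)) :=
    ((continuous_coe_real_ereal.comp hf).tendsto 0).mono_left nhdsWithin_le_nhds
  exact ge_of_tendsto h (Filter.eventually_of_mem self_mem_nhdsWithin hW)

theorem EReal.iSup_coe_eq_of_isLUB {β : Type*} {s : Set β} {f : β → ℝ} {b : ℝ}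
    (hb : IsLUB (f '' s) b) : ⨆ a ∈ s, (f a : EReal) = b := by
  apply le_antisymm
  · exact iSup₂_le fun a ha => EReal.coe_le_coe_iff.2 (hb.1 ⟨a, ha, rfl⟩)
  · have h := EReal.coe_le_of_forall_pos (f := fun ε => b - ε) (by fun_prop)
      (W := ⨆ a ∈ s, (f a : EReal)) fun ε hε => by
        obtain ⟨_, ⟨a, ha, rfl⟩, hlt, -⟩ := hb.exists_between (sub_lt_self b hε)
        exact (EReal.coe_le_coe_iff.2 hlt.le).trans (le_iSup₂ (f := fun a _ => (f a : EReal)) a ha)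
    simpa using h

/-- Positive and negative parts are arranged so that no subtraction occurs: this form can be
integrated without knowing that either side is integrable. -/
theorem ENNReal.ofReal_add_ofReal_neg_le {x y t : ℝ} (ht : 0 ≤ t) (h : x ≤ y + t) :
    ENNReal.ofReal x + ENNReal.ofReal (-y)
      ≤ ENNReal.ofReal (-x) + (ENNReal.ofReal y + ENNReal.ofReal t) := by
  rw [← ENNReal.toReal_le_toReal (by finiteness) (by finiteness),
    ENNReal.toReal_add (by finiteness) (by finiteness),
    ENNReal.toReal_add (by finiteness) (by finiteness),
    ENNReal.toReal_add (by finiteness) (by finiteness)]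
  simp only [ENNReal.toReal_ofReal']
  grind

/-! ### Extended expectations and the transport upper bound -/

section Expectation

variable {Z : Type*} [MeasurableSpace Z]

theorem eExp_coe {P : Measure Z} {f : Z → ℝ} (hf : Integrable f P) :
    eExp P (fun z => (f z : EReal)) = ((∫ z, f z ∂P : ℝ) : EReal) := by
  have hp : ∫⁻ z, ENNReal.ofReal (f z) ∂P ≠ ⊤ := by
    exact ((lintegral_mono fun z => Real.ofReal_le_enorm (f z)).trans_lt hf.2).ne
  have hn : ∫⁻ z, ENNReal.ofReal (-f z) ∂P ≠ ⊤ := by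
    exact ((lintegral_mono fun z => Real.ofReal_le_enorm (-f z)).trans_lt hf.neg.2).ne
  rw [integral_eq_lintegral_pos_part_sub_lintegral_neg_part hf, eExp, EReal.coe_sub,
    EReal.coe_ennreal_toReal hp, EReal.coe_ennreal_toReal hn]
  simp only [← EReal.coe_neg, EReal.toENNReal_of_ne_top (EReal.coe_ne_top _), EReal.toReal_coe]

theorem integrable_of_empirical [MeasurableSingletonClass Z] {N : ℕ} (hN : 0 < N)
    (z : Fin N → Z) (f : Z → ℝ) : Integrable f (empirical z) := by
  refine Integrable.smul_measure ?_ (by simpa using hN.ne')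
  exact integrable_finsetSum_measure.2 fun i _ => integrable_dirac (by simp)

theorem integral_empirical [MeasurableSingletonClass Z] {N : ℕ} (z : Fin N → Z) (f : Z → ℝ) :
    ∫ x, f x ∂(empirical z) = (N : ℝ)⁻¹ * ∑ i, f (z i) := by
  rw [empirical, integral_smul_measure, integral_finsetSum_measure]
  · simp
  · exact fun i _ => integrable_dirac (by simp)

theorem isProbabilityMeasure_empirical {N : ℕ} (hN : 0 < N) (z : Fin N → Z) :
    IsProbabilityMeasure (empirical z) := by
  constructor
  simp only [empirical, Measure.smul_apply, Measure.coe_finsetSum, Finset.sum_apply,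
    measure_univ, Finset.sum_const, Finset.card_univ, Fintype.card_fin, nsmul_eq_mul, mul_one,
    smul_eq_mul]
  exact ENNReal.inv_mul_cancel (by exact_mod_cast hN.ne') (ENNReal.natCast_ne_top N)

theorem map_empirical {Z' : Type*} [MeasurableSpace Z'] {N : ℕ} (z : Fin N → Z) {f : Z → Z'}
    (hf : Measurable f) : (empirical z).map f = empirical (f ∘ z) := by
  rw [empirical, empirical, Measure.map_smul, Measure.map_finset_sum hf.aemeasurable]
  simp [Measure.map_dirac' hf]

theorem lintegral_empirical_le [MeasurableSingletonClass Z] {N : ℕ} (z : Fin N → Z)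
    {f : Z → ℝ≥0∞} {C : ℝ≥0∞} (hf : ∀ i, f (z i) ≤ C) :
    ∫⁻ x, f x ∂(empirical z) ≤ C := by
  rw [empirical, lintegral_smul_measure, lintegral_finsetSum_measure]
  simp only [lintegral_dirac, smul_eq_mul]
  calc (N : ℝ≥0∞)⁻¹ * ∑ i, f (z i) ≤ (N : ℝ≥0∞)⁻¹ * ∑ _i : Fin N, C := by
        gcongr with i; exact hf i
    _ = (N : ℝ≥0∞)⁻¹ * N * C := by simp [mul_assoc]
    _ ≤ 1 * C := by gcongr; exact ENNReal.inv_mul_le_one _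
    _ = C := one_mul C

/-- If `f z' ≤ φ z + K * c z z'`, then moving mass at transport cost `δ` raises the expectation of
`f` above that of `φ` by at most `δ * K`. -/
theorem eExp_le_of_otCost_le {c : Z → Z → ℝ≥0∞} {P Q : Measure Z} {f φ : Z → ℝ} {δ K : ℝ}
    (hf : Measurable f) (hφ : Integrable φ P) (hδ : 0 ≤ δ) (hK : 0 ≤ K)
    (hc : ∀ z z', c z z' ≠ ⊤ → f z' ≤ φ z + K * (c z z').toReal)
    (hPQ : otCost c 1 P Q ≤ ENNReal.ofReal δ) :
    eExp Q (fun z => (f z : EReal)) ≤ ((∫ z, φ z ∂P + δ * K : ℝ) : EReal) := by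
  -- `δ + ε` because the infimum over couplings need not be attained; `K + ε` so that an infinite
  -- cost still gives `⊤` when `K = 0`.
  have key := EReal.le_coe_of_forall_pos
    (f := fun ε => ∫ z, φ z ∂P + (δ + ε) * (K + ε)) (by fun_prop)
    (W := eExp Q fun z => (f z : EReal)) ?_
  · simpa using key
  intro ε hε
  have hlt : otCost c 1 P Q < ENNReal.ofReal (δ + ε) :=
    hPQ.trans_lt ((ENNReal.ofReal_lt_ofReal_iff (by linarith)).2 (by linarith))
  simp only [otCost, div_one, ENNReal.rpow_one, iInf_lt_iff] at hlt
  obtain ⟨π, ⟨h1, h2⟩, hπ⟩ := hlt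
  have hpos : ∀ z z', ENNReal.ofReal (f z') + ENNReal.ofReal (-φ z)
      ≤ ENNReal.ofReal (-f z') + (ENNReal.ofReal (φ z) + ENNReal.ofReal (K + ε) * c z z') := by
    intro z z'
    by_cases hz : c z z' = ⊤
    · rw [hz, ENNReal.mul_top (by simpa using by linarith)]
      simp
    · have hc0 : 0 ≤ (c z z').toReal := ENNReal.toReal_nonneg
      rw [← ENNReal.ofReal_toReal hz, ← ENNReal.ofReal_mul (by linarith)]
      exact ENNReal.ofReal_add_ofReal_neg_le (by positivity) (by nlinarith [hc z z' hz])
  have hφ1 : AEMeasurable φ (π.map Prod.fst) := h1 ▸ hφ.aemeasurable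
  have hφ2 : AEMeasurable (fun w : Z × Z => φ w.1) π := hφ1.comp_measurable measurable_fst
  have hint := lintegral_mono (μ := π) fun w => hpos w.1 w.2
  -- The cost need not be measurable: it is always the right-hand summand, and its scalar factor is
  -- finite.
  rw [lintegral_add_left (by fun_prop), lintegral_add_left (by fun_prop),
    lintegral_add_left' (by fun_prop), lintegral_const_mul' _ _ ENNReal.ofReal_ne_top,
    ← lintegral_map (f := fun z' => ENNReal.ofReal (f z')) (by fun_prop) measurable_snd,
    ← lintegral_map (f := fun z' => ENNReal.ofReal (-f z')) (by fun_prop) measurable_snd,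
    ← lintegral_map' (f := fun z => ENNReal.ofReal (φ z)) (by fun_prop)
      measurable_fst.aemeasurable,
    ← lintegral_map' (f := fun z => ENNReal.ofReal (-φ z)) (by fun_prop)
      measurable_fst.aemeasurable, h1, h2] at hint
  have hp : ∫⁻ z, ENNReal.ofReal (φ z) ∂P ≠ ⊤ :=
    ((lintegral_mono fun z => Real.ofReal_le_enorm (φ z)).trans_lt hφ.2).ne
  have hn : ∫⁻ z, ENNReal.ofReal (-φ z) ∂P ≠ ⊤ :=
    ((lintegral_mono fun z => Real.ofReal_le_enorm (-φ z)).trans_lt hφ.neg.2).ne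
  have hcost : ENNReal.ofReal (K + ε) * ∫⁻ w, c w.1 w.2 ∂π
      ≤ ENNReal.ofReal ((δ + ε) * (K + ε)) := by
    rw [mul_comm (δ + ε), ENNReal.ofReal_mul (by linarith)]
    gcongr
  rw [integral_eq_lintegral_pos_part_sub_lintegral_neg_part hφ, eExp]
  simp only [← EReal.coe_neg, EReal.toENNReal_of_ne_top (EReal.coe_ne_top _), EReal.toReal_coe]
  replace hint := hint.trans (add_le_add_right (add_le_add_right hcost _) _)
  have hδK : 0 ≤ (δ + ε) * (K + ε) := by positivity
  revert hint hp hn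
  generalize (∫⁻ z, ENNReal.ofReal (f z) ∂Q) = a
  generalize (∫⁻ z, ENNReal.ofReal (-f z) ∂Q) = b
  generalize (∫⁻ z, ENNReal.ofReal (φ z) ∂P) = p
  generalize (∫⁻ z, ENNReal.ofReal (-φ z) ∂P) = n
  generalize (δ + ε) * (K + ε) = t at hδK ⊢
  intro hp hn hint
  -- An infinite negative part makes the expectation `⊥`, even when the positive part is infinite
  -- too.
  by_cases hb : b = ⊤
  · simp [hb]
  have ha : a ≠ ⊤ := ne_top_of_le_ne_top (by finiteness) (le_self_add.trans hint)
  lift a to NNReal using ha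
  lift b to NNReal using hb
  lift p to NNReal using hp
  lift n to NNReal using hn
  rw [← ENNReal.toReal_le_toReal (by finiteness) (by finiteness),
    ENNReal.toReal_add (by finiteness) (by finiteness),
    ENNReal.toReal_add (by finiteness) (by finiteness),
    ENNReal.toReal_add (by finiteness) (by finiteness), ENNReal.toReal_ofReal hδK] at hint
  simp only [ENNReal.coe_toReal] at hint ⊢
  have e : ((a : ℝ≥0∞) : EReal) - ((b : ℝ≥0∞) : EReal) = ((a - b : ℝ) : EReal) := rfl
  rw [e, EReal.coe_le_coe_iff]
  linarith

end Expectation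

/-! ### Dual norm -/

theorem Seminorm.exists_abs_le_of_finiteDimensional {V : Type*} [AddCommGroup V] [Module ℝ V]
    [FiniteDimensional ℝ V] (p : Seminorm ℝ V) (hp : ∀ x, p x = 0 → x = 0) (f : V →ₗ[ℝ] ℝ) :
    ∃ C, ∀ x, |f x| ≤ C * p x := by
  let _ : NormedAddCommGroup V := AddGroupNorm.toNormedAddCommGroup
    { p.toAddGroupSeminorm with eq_zero_of_map_eq_zero' := hp }
  let _ : NormedSpace ℝ V := ⟨fun a b => (map_smul_eq_mul p a b).le⟩
  exact ⟨‖f.toContinuousLinearMap‖, fun x => f.toContinuousLinearMap.le_opNorm x⟩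

section DualNorm

variable {χ : Type*} [Fintype χ]

/-- Linear functionals are continuous in finite dimension. Without this bound the real `sSup` in
`dualNorm` could take its default value `0`. -/
theorem bddAbove_dualNorm (nrm : Seminorm ℝ (χ → ℝ)) (hnrm : ∀ x, nrm x = 0 → x = 0)
    (q : χ → ℝ) : BddAbove {r : ℝ | ∃ x' : χ → ℝ, nrm x' ≤ 1 ∧ r = q ⬝ᵥ x'} := by
  obtain ⟨C, hC⟩ := nrm.exists_abs_le_of_finiteDimensional hnrm (dotProductBilin ℝ ℝ q)
  refine ⟨|C|, ?_⟩
  rintro _ ⟨x, hx, rfl⟩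
  have h : |q ⬝ᵥ x| ≤ C * nrm x := hC x
  calc q ⬝ᵥ x ≤ C * nrm x := (le_abs_self _).trans h
    _ ≤ |C| * 1 := by
      gcongr
      exact le_abs_self C
    _ = |C| := mul_one _

theorem dualNorm_nonneg (nrm : Seminorm ℝ (χ → ℝ)) (hnrm : ∀ x, nrm x = 0 → x = 0)
    (q : χ → ℝ) : 0 ≤ dualNorm nrm q :=
  le_csSup (bddAbove_dualNorm nrm hnrm q) ⟨0, by simp, by simp⟩

theorem dotProduct_le_dualNorm_mul (nrm : Seminorm ℝ (χ → ℝ)) (hnrm : ∀ x, nrm x = 0 → x = 0)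
    (q x : χ → ℝ) : q ⬝ᵥ x ≤ dualNorm nrm q * nrm x := by
  rcases (apply_nonneg nrm x).eq_or_lt with h | h
  · simp [hnrm x h.symm]
  · have h1 : q ⬝ᵥ ((nrm x)⁻¹ • x) ≤ dualNorm nrm q :=
      le_csSup (bddAbove_dualNorm nrm hnrm q)
        ⟨_, by rw [map_smul_eq_mul, norm_inv, Real.norm_of_nonneg h.le, inv_mul_cancel₀ h.ne'], rfl⟩
    rwa [dotProduct_smul, smul_eq_mul, inv_mul_le_iff₀ h, mul_comm] at h1

theorem abs_dotProduct_le_dualNorm_mul (nrm : Seminorm ℝ (χ → ℝ))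
    (hnrm : ∀ x, nrm x = 0 → x = 0) (q x : χ → ℝ) : |q ⬝ᵥ x| ≤ dualNorm nrm q * nrm x := by
  refine abs_le'.2 ⟨dotProduct_le_dualNorm_mul nrm hnrm q x, ?_⟩
  simpa using dotProduct_le_dualNorm_mul nrm hnrm q (-x)

theorem exists_dualNorm_sub_le (nrm : Seminorm ℝ (χ → ℝ)) (q : χ → ℝ) {ε : ℝ} (hε : 0 < ε) :
    ∃ x, nrm x ≤ 1 ∧ dualNorm nrm q - ε ≤ q ⬝ᵥ x := by
  obtain ⟨_, ⟨x, hx, rfl⟩, h⟩ := exists_lt_of_lt_csSup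
    (s := {r : ℝ | ∃ x' : χ → ℝ, nrm x' ≤ 1 ∧ r = q ⬝ᵥ x'}) ⟨_, 0, by simp, rfl⟩
    (sub_lt_self (dualNorm nrm q) hε)
  exact ⟨x, hx, h.le⟩

end DualNorm

/-! ### Mixtures of empirical distributions as test measures -/

section Mixture

variable {Z : Type*} [MeasurableSpace Z] {N : ℕ}

/-- The mixture `(1 - η) P + η Q` of two empirical distributions. -/
noncomputable def empiricalMix (η : ℝ) (z z' : Fin N → Z) : Measure Z :=
  ENNReal.ofReal (1 - η) • empirical z + ENNReal.ofReal η • empirical z'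

theorem map_empiricalMix {Z' : Type*} [MeasurableSpace Z'] (η : ℝ) (z z' : Fin N → Z)
    {f : Z → Z'} (hf : Measurable f) :
    (empiricalMix η z z').map f = empiricalMix η (f ∘ z) (f ∘ z') := by
  rw [empiricalMix, Measure.map_add _ _ hf, Measure.map_smul, Measure.map_smul,
    map_empirical _ hf, map_empirical _ hf, empiricalMix]

theorem ofReal_one_sub_add_ofReal {η : ℝ} (h0 : 0 ≤ η) (h1 : η ≤ 1) :
    ENNReal.ofReal (1 - η) + ENNReal.ofReal η = 1 := by
  rw [← ENNReal.ofReal_add (by linarith) h0, sub_add_cancel, ENNReal.ofReal_one]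

theorem empiricalMix_self {η : ℝ} (h0 : 0 ≤ η) (h1 : η ≤ 1) (z : Fin N → Z) :
    empiricalMix η z z = empirical z := by
  rw [empiricalMix, ← add_smul, ofReal_one_sub_add_ofReal h0 h1, one_smul]

variable [MeasurableSingletonClass Z]

theorem eExp_empiricalMix (hN : 0 < N) {η : ℝ} (h0 : 0 ≤ η) (h1 : η ≤ 1) (z z' : Fin N → Z)
    (f : Z → ℝ) : eExp (empiricalMix η z z') (fun x => (f x : EReal)) =
      (((1 - η) * ((N : ℝ)⁻¹ * ∑ i, f (z i)) + η * ((N : ℝ)⁻¹ * ∑ i, f (z' i)) : ℝ) : EReal) := by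
  have i1 := (integrable_of_empirical hN z f).smul_measure (c := ENNReal.ofReal (1 - η))
    ENNReal.ofReal_ne_top
  have i2 := (integrable_of_empirical hN z' f).smul_measure (c := ENNReal.ofReal η)
    ENNReal.ofReal_ne_top
  rw [empiricalMix, eExp_coe (i1.add_measure i2), integral_add_measure i1 i2,
    integral_smul_measure, integral_smul_measure, integral_empirical, integral_empirical,
    ENNReal.toReal_ofReal h0, ENNReal.toReal_ofReal (by linarith), smul_eq_mul, smul_eq_mul]

/-- Couple by splitting each atom: the share `1 - η` travels for free, the share `η` at cost at most
`B`. -/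
theorem empiricalMix_mem_ambiguitySet (hN : 0 < N) {c : Z → Z → ℝ≥0∞} {η B δ : ℝ} (h0 : 0 ≤ η)
    (h1 : η ≤ 1) (hB : η * B ≤ δ) {z z' z'' : Fin N → Z} (hz' : ∀ i, c (z i) (z' i) = 0)
    (hz'' : ∀ i, c (z i) (z'' i) ≤ ENNReal.ofReal B) :
    empiricalMix η z' z'' ∈ ambiguitySet c 1 δ (empirical z) := by
  constructor
  · have := isProbabilityMeasure_empirical hN z'
    have := isProbabilityMeasure_empirical hN z''
    constructor
    simp [empiricalMix, ofReal_one_sub_add_ofReal h0 h1]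
  · simp only [otCost, div_one, ENNReal.rpow_one]
    refine iInf₂_le_of_le (empiricalMix η (fun i => (z i, z' i)) (fun i => (z i, z'' i))) ⟨?_, ?_⟩
      ?_
    · rw [map_empiricalMix _ _ _ measurable_fst]
      exact empiricalMix_self h0 h1 z
    · rw [map_empiricalMix _ _ _ measurable_snd]
      rfl
    · rw [empiricalMix, lintegral_add_measure, lintegral_smul_measure, lintegral_smul_measure]
      calc _ ≤ ENNReal.ofReal (1 - η) • (0 : ℝ≥0∞) + ENNReal.ofReal η • ENNReal.ofReal B := by
            gcongr
            · exact lintegral_empirical_le _ fun i => (hz' i).le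
            · exact lintegral_empirical_le _ hz''
        _ = ENNReal.ofReal (η * B) := by
            rw [smul_zero, zero_add, smul_eq_mul, ENNReal.ofReal_mul h0]
        _ ≤ ENNReal.ofReal δ := ENNReal.ofReal_le_ofReal hB

end Mixture

/-! ### Scores and shifts in semi-latent coordinates -/

section Shift

variable {α χ : Type*} [Fintype α] [Fintype χ] [DecidableEq α] [DecidableEq χ]

theorem dotProduct_semiLatentInv_mulVec (S : LinearSCM (α ⊕ χ)) (θ : α ⊕ χ → ℝ) (a : α → ℝ)
    (x : χ → ℝ) : θ ⬝ᵥ (S.semiLatentInv *ᵥ Sum.elim a x) =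
      projA (S.semiLatentInvᵀ *ᵥ θ) ⬝ᵥ a + projX (S.semiLatentInvᵀ *ᵥ θ) ⬝ᵥ x := by
  rw [Matrix.dotProduct_mulVec, ← Matrix.mulVec_transpose, dotProduct, Fintype.sum_sum_type]
  rfl

theorem dotProduct_twin (S : LinearSCM (α ⊕ χ)) (θ v : α ⊕ χ → ℝ) (a : α → ℝ) :
    θ ⬝ᵥ S.twin v a = projA (S.semiLatentInvᵀ *ᵥ θ) ⬝ᵥ a
      + projX (S.semiLatentInvᵀ *ᵥ θ) ⬝ᵥ projX (S.semiLatent v) :=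
  dotProduct_semiLatentInv_mulVec S θ a _

/-- Consistency of counterfactuals; it lets an arbitrary `v'` be compared with a twin of `v` at the
same sensitive level. -/
theorem LinearSCM.twin_projA (S : LinearSCM (α ⊕ χ)) (v : α ⊕ χ → ℝ) :
    S.twin v (projA v) = v := by
  conv_rhs => rw [← S.semiLatentInv_semiLatent v]
  rfl

variable {𝒜 : Set (α → ℝ)} {𝒴 : Set ℝ}

/-- The observation with sensitive part `a`, with `x` added to the exogenous variables of the
non-sensitive part of `z`, and with the label of `z`. -/
noncomputable def shiftObs (S : LinearSCM (α ⊕ χ)) (z : ObsSpace χ 𝒜 𝒴) (a : 𝒜) (x : χ → ℝ) :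
    ObsSpace χ 𝒜 𝒴 :=
  (⟨S.semiLatentInv *ᵥ Sum.elim a.1 (projX (S.semiLatent z.1.1) + x), by
    have h : projA (S.semiLatentInv *ᵥ Sum.elim a.1 (projX (S.semiLatent z.1.1) + x)) = a.1 :=
      congrArg projA (S.semiLatent_semiLatentInv (Sum.elim a.1 (projX (S.semiLatent z.1.1) + x)))
    exact (congrArg (· ∈ 𝒜) h).mpr a.2⟩, z.2)

theorem transportCost_shiftObs (S : LinearSCM (α ⊕ χ)) (nrm : Seminorm ℝ (χ → ℝ))
    (z : ObsSpace χ 𝒜 𝒴) (a : 𝒜) (x : χ → ℝ) :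
    transportCost S nrm z (shiftObs S z a x) = ENNReal.ofReal (nrm x) := by
  have h : projX (S.semiLatent (shiftObs S z a x).1.1) = projX (S.semiLatent z.1.1) + x :=
    congrArg projX (S.semiLatent_semiLatentInv (Sum.elim a.1 (projX (S.semiLatent z.1.1) + x)))
  rw [transportCost, cfdf, h]
  simp [shiftObs, map_neg_eq_map]

theorem dotProduct_shiftObs (S : LinearSCM (α ⊕ χ)) (θ : α ⊕ χ → ℝ) (z : ObsSpace χ 𝒜 𝒴)
    (a : 𝒜) (x : χ → ℝ) : θ ⬝ᵥ (shiftObs S z a x).1.1 =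
      θ ⬝ᵥ S.twin z.1.1 a + projX (S.semiLatentInvᵀ *ᵥ θ) ⬝ᵥ x := by
  rw [dotProduct_twin, shiftObs, dotProduct_semiLatentInv_mulVec, dotProduct_add, add_assoc]

end Shift

/-! ### Bounds on the worst-case risk -/

section WorstRisk

variable {α χ : Type*} [Fintype α] [Fintype χ] [DecidableEq α] [DecidableEq χ]
  {S : LinearSCM (α ⊕ χ)} {nrm : Seminorm ℝ (χ → ℝ)} {𝒜 : Set (α → ℝ)} {𝒴 : Set ℝ}
  {N : ℕ} {z : Fin N → ObsSpace χ 𝒜 𝒴} {δ : ℝ} {θ : α ⊕ χ → ℝ} {h : ℝ → ℝ} {L : ℝ}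
  {b σ : ℝ → ℝ} {ℓ : (α ⊕ χ → ℝ) → ℝ → ℝ}

theorem shift_le_worstRisk (hN : 0 < N) {η B : ℝ} (h0 : 0 ≤ η) (h1 : η ≤ 1)
    (hB : η * B ≤ δ) (hℓ : ∀ v y, ℓ v y = h (b y + σ y * (θ ⬝ᵥ v))) (a : Fin N → 𝒜)
    {x : Fin N → χ → ℝ} (hx : ∀ i, nrm (x i) ≤ B) :
    (((1 - η) * ((N : ℝ)⁻¹ * ∑ i, ℓ (S.twin (z i).1.1 (a i)) (z i).2)
      + η * ((N : ℝ)⁻¹ * ∑ i, h (b (z i).2 + σ (z i).2 * (θ ⬝ᵥ S.twin (z i).1.1 (a i)) +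
        σ (z i).2 * (projX (S.semiLatentInvᵀ *ᵥ θ) ⬝ᵥ x i))) : ℝ) : EReal)
      ≤ worstRisk S nrm 1 δ ℓ (empirical z) := by
  refine le_of_eq_of_le ?_ (le_iSup₂ (f := fun Q _ => risk ℓ Q)
    (empiricalMix η (fun i => shiftObs S (z i) (a i) 0) (fun i => shiftObs S (z i) (a i) (x i)))
    (empiricalMix_mem_ambiguitySet hN h0 h1 hB (fun i => ?_) (fun i => ?_)))
  · rw [risk, eExp_empiricalMix hN h0 h1]
    simp only [hℓ, dotProduct_shiftObs, dotProduct_zero, add_zero, mul_add, add_assoc]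
    rfl
  · simp [transportCost_shiftObs]
  · rw [transportCost_shiftObs]
    exact ENNReal.ofReal_le_ofReal (hx i)

theorem twin_le_worstRisk (hN : 0 < N) (hδ : 0 ≤ δ)
    (hℓ : ∀ v y, ℓ v y = h (b y + σ y * (θ ⬝ᵥ v))) (a : Fin N → 𝒜) :
    (((N : ℝ)⁻¹ * ∑ i, ℓ (S.twin (z i).1.1 (a i)) (z i).2 : ℝ) : EReal)
      ≤ worstRisk S nrm 1 δ ℓ (empirical z) := by
  simpa using shift_le_worstRisk (S := S) (nrm := nrm) (z := z) hN (η := 0) (B := 0) le_rfl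
    zero_le_one (by simpa using hδ) hℓ a (x := 0) (by simp)

theorem twin_add_le_worstRisk (hN : 0 < N) (hδ : 0 ≤ δ) (hL : 0 ≤ L)
    (hSlope : ∃ t : ℕ → ℝ, Filter.Tendsto (fun k => |t k|) Filter.atTop Filter.atTop ∧
      ∀ t₀ : ℝ, Filter.Tendsto (fun k => (h (t₀ + t k) - h t₀) / |t k|) Filter.atTop (nhds L))
    (hℓ : ∀ v y, ℓ v y = h (b y + σ y * (θ ⬝ᵥ v))) (hσ : ∀ y ∈ 𝒴, |σ y| = 1)
    (a : Fin N → 𝒜) {x : χ → ℝ} (hx : nrm x ≤ 1) :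
    (((N : ℝ)⁻¹ * ∑ i, ℓ (S.twin (z i).1.1 (a i)) (z i).2
        + δ * L * (projX (S.semiLatentInvᵀ *ᵥ θ) ⬝ᵥ x) : ℝ) : EReal)
      ≤ worstRisk S nrm 1 δ ℓ (empirical z) := by
  obtain ⟨t, ht, hlim⟩ := hSlope
  set d := projX (S.semiLatentInvᵀ *ᵥ θ) ⬝ᵥ x with hd
  -- If `d ≤ 0` the extra term is no gain, and the free twins already suffice.
  rcases le_or_gt d 0 with hd0 | hd0
  · refine le_trans (EReal.coe_le_coe_iff.2 ?_) (twin_le_worstRisk hN hδ hℓ a)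
    nlinarith [mul_nonneg hδ hL]
  set T : Fin N → ℝ := fun i => b (z i).2 + σ (z i).2 * (θ ⬝ᵥ S.twin (z i).1.1 (a i)) with hT
  have hlim' : Filter.Tendsto (fun k => (N : ℝ)⁻¹ * ∑ i, h (T i) +
      δ * ((N : ℝ)⁻¹ * ∑ i, (h (T i + t k) - h (T i)) / |t k|) * d) Filter.atTop
      (nhds ((N : ℝ)⁻¹ * ∑ i, h (T i) + δ * ((N : ℝ)⁻¹ * ∑ _i : Fin N, L) * d)) :=
    (((tendsto_finsetSum _ fun i _ => hlim (T i)).const_mul _).const_mul δ).mul_const d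
      |>.const_add _
  have hNL : (N : ℝ)⁻¹ * ∑ _i : Fin N, L = L := by
    have : (N : ℝ) ≠ 0 := by exact_mod_cast hN.ne'
    simp [this]
  rw [hNL] at hlim'
  simp only [hℓ]
  refine le_of_tendsto ((continuous_coe_real_ereal.tendsto _).comp hlim') ?_
  filter_upwards [ht.eventually_ge_atTop (δ * d), ht.eventually_gt_atTop 0] with k hk hk0
  have hσ1 : ∀ i, |σ (z i).2| = 1 := fun i => hσ _ (z i).2.2
  -- The displacement is chosen to shift the argument of `h` by exactly `t k`; its sign `σ` cancels
  -- the outer one since `σ² = 1`. It has length at most `|t k| / d`, so the fraction `δ * d / |t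
  -- k|` exhausts the budget `δ`, and the gain is `δ * d` times the mean difference quotient, which
  -- tends to `L`.
  refine le_of_eq_of_le ?_ (shift_le_worstRisk (S := S) (nrm := nrm) (z := z) (δ := δ) hN
    (η := δ * d / |t k|) (B := |t k| / d) (by positivity) ((div_le_one hk0).2 hk)
    (le_of_eq (by field_simp)) hℓ a (x := fun i => (σ (z i).2 * (t k / d)) • x) ?_)
  · have hstep : ∀ i, σ (z i).2 *
        (projX (S.semiLatentInvᵀ *ᵥ θ) ⬝ᵥ ((σ (z i).2 * (t k / d)) • x)) = t k := by
      intro i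
      have : σ (z i).2 * σ (z i).2 = 1 := by rw [← abs_mul_abs_self, hσ1, one_mul]
      rw [dotProduct_smul, ← hd, smul_eq_mul]
      field_simp
      linear_combination t k * this
    simp only [hstep, hℓ, Function.comp]
    congr 1
    rw [← Finset.sum_div, Finset.sum_sub_distrib]
    ring
  · intro i
    rw [map_smul_eq_mul, norm_mul, Real.norm_eq_abs, hσ1, one_mul, Real.norm_eq_abs, abs_div,
      abs_of_pos hd0]
    exact mul_le_of_le_one_right (by positivity) hx

/-- Taking the supremum over twins as a real function `φ` treats bounded `𝒜` and vanishing sensitive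
weight together. -/
theorem worstRisk_eq_of_isLUB (hnrm : ∀ x, nrm x = 0 → x = 0) (hN : 0 < N) (hδ : 0 ≤ δ)
    (hLip : ∀ t₁ t₂ : ℝ, |h t₂ - h t₁| ≤ L * |t₂ - t₁|)
    (hSlope : ∃ t : ℕ → ℝ, Filter.Tendsto (fun k => |t k|) Filter.atTop Filter.atTop ∧
      ∀ t₀ : ℝ, Filter.Tendsto (fun k => (h (t₀ + t k) - h t₀) / |t k|) Filter.atTop (nhds L))
    (hb : Measurable b) (hσm : Measurable σ)
    (hℓ : ∀ v y, ℓ v y = h (b y + σ y * (θ ⬝ᵥ v))) (hσ : ∀ y ∈ 𝒴, |σ y| = 1)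
    {φ : ObsSpace χ 𝒜 𝒴 → ℝ}
    (hφ : ∀ z : ObsSpace χ 𝒜 𝒴, IsLUB ((fun a => ℓ (S.twin z.1.1 a) z.2) '' 𝒜) (φ z)) :
    worstRisk S nrm 1 δ ℓ (empirical z) = eExp (empirical z) (fun z => (φ z : EReal))
      + ((δ * L * dualNorm nrm (projX (S.semiLatentInvᵀ *ᵥ θ)) : ℝ) : EReal) := by
  have hL : 0 ≤ L := by simpa using (abs_nonneg _).trans (hLip 0 1)
  have hhc : Continuous h := (LipschitzWith.of_dist_le_mul (K := ⟨L, hL⟩) fun x y => by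
    rw [dist_comm x, dist_comm (h x), Real.dist_eq, Real.dist_eq]
    exact hLip x y).continuous
  set q := projX (S.semiLatentInvᵀ *ᵥ θ) with hq
  have hD := dualNorm_nonneg nrm hnrm q
  rw [eExp_coe (integrable_of_empirical hN z φ), ← EReal.coe_add]
  apply le_antisymm
  · refine iSup₂_le fun Q hQ => ?_
    rw [mul_assoc]
    refine eExp_le_of_otCost_le (f := fun z : ObsSpace χ 𝒜 𝒴 => ℓ z.1.1 z.2) ?_
      (integrable_of_empirical hN z φ) hδ (mul_nonneg hL hD) ?_ hQ.2
    · simp only [hℓ, dotProduct]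
      refine hhc.measurable.comp (((hb.comp measurable_subtype_coe).comp measurable_snd).add
        (((hσm.comp measurable_subtype_coe).comp measurable_snd).mul
          (Finset.measurable_fun_sum _ fun i _ => ?_)))
      exact ((measurable_pi_apply i).comp (measurable_subtype_coe.comp measurable_fst)).const_mul _
    · intro w w' hw
      -- Distinct labels would make the cost infinite.
      have hy : (w.2 : ℝ) = w'.2 := by
        by_contra hne
        apply hw
        rw [transportCost, ENNReal.top_mul, add_top]
        simpa [sub_eq_zero] using hne
      have hc : (transportCost S nrm w w').toReal = cfdf S nrm w.1.1 w'.1.1 := by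
        rw [transportCost, hy]
        simp [cfdf]
      rw [hc, cfdf]
      -- This twin of `w` differs from `w'` only in the non-sensitive latent part, so the Lipschitz
      -- bound and duality control the rest.
      have h1 : ℓ (S.twin w.1.1 (projA w'.1.1)) w.2 ≤ φ w := (hφ w).1 ⟨_, w'.1.2, rfl⟩
      have h2 : ℓ w'.1.1 w'.2 - ℓ (S.twin w.1.1 (projA w'.1.1)) w.2
          ≤ L * (dualNorm nrm q * nrm (projX (S.semiLatent w.1.1) - projX (S.semiLatent w'.1.1))) := by
        rw [hℓ, hℓ, hy]
        refine ((le_abs_self _).trans (hLip _ _)).trans ?_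
        refine mul_le_mul_of_nonneg_left ?_ hL
        rw [add_sub_add_left_eq_sub, ← mul_sub, abs_mul, hσ _ w'.2.2, one_mul]
        nth_rw 1 [← S.twin_projA w'.1.1]
        rw [dotProduct_twin, dotProduct_twin, add_sub_add_left_eq_sub, ← dotProduct_sub,
          map_sub_rev]
        exact abs_dotProduct_le_dualNorm_mul nrm hnrm q _
      linarith
  · rw [integral_empirical]
    have key := EReal.coe_le_of_forall_pos
      (f := fun ε => (N : ℝ)⁻¹ * ∑ i, (φ (z i) - ε) + δ * L * (dualNorm nrm q - ε)) (by fun_prop)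
      (W := worstRisk S nrm 1 δ ℓ (empirical z)) ?_
    · simpa using key
    intro ε hε
    have ha : ∀ i, ∃ a : 𝒜, φ (z i) - ε ≤ ℓ (S.twin (z i).1.1 a) (z i).2 := fun i => by
      obtain ⟨_, ⟨a, ha, rfl⟩, hlt, -⟩ := (hφ (z i)).exists_between (sub_lt_self _ hε)
      exact ⟨⟨a, ha⟩, hlt.le⟩
    choose a ha using ha
    obtain ⟨x, hx, hx'⟩ := exists_dualNorm_sub_le nrm q hε
    refine le_trans (EReal.coe_le_coe_iff.2 ?_)
      (twin_add_le_worstRisk hN hδ hL hSlope hℓ hσ a hx)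
    gcongr with i
    exact ha i

/-- Positive slope forces `h (t k) → ∞`, and a free change of sensitive values brings the argument
of `h` within a fixed distance of any `t k`. -/
theorem worstRisk_eq_top (hN : 0 < N) (hδ : 0 ≤ δ) (hL : 0 < L)
    (hLip : ∀ t₁ t₂ : ℝ, |h t₂ - h t₁| ≤ L * |t₂ - t₁|)
    (hSlope : ∃ t : ℕ → ℝ, Filter.Tendsto (fun k => |t k|) Filter.atTop Filter.atTop ∧
      ∀ t₀ : ℝ, Filter.Tendsto (fun k => (h (t₀ + t k) - h t₀) / |t k|) Filter.atTop (nhds L))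
    (hℓ : ∀ v y, ℓ v y = h (b y + σ y * (θ ⬝ᵥ v))) (hσ : ∀ y ∈ 𝒴, |σ y| = 1)
    (hp : projA (S.semiLatentInvᵀ *ᵥ θ) ≠ 0)
    (hr : ∃ r : ℝ, ∀ a : α → ℝ, ∃ a' ∈ 𝒜, dist a a' ≤ r) :
    worstRisk S nrm 1 δ ℓ (empirical z) = ⊤ := by
  obtain ⟨t, ht, hlim⟩ := hSlope
  obtain ⟨r, hr⟩ := hr
  set p := projA (S.semiLatentInvᵀ *ᵥ θ) with hpdef
  have hpp : p ⬝ᵥ p ≠ 0 := fun h0 => hp (dotProduct_self_eq_zero.1 h0)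
  obtain ⟨C, hC⟩ : ∃ C, ∀ a : α → ℝ, |p ⬝ᵥ a| ≤ C * ‖a‖ :=
    ⟨_, fun a => (dotProductBilin ℝ ℝ p).toContinuousLinearMap.le_opNorm a⟩
  have htop : Filter.Tendsto (fun k => h (t k)) Filter.atTop Filter.atTop := by
    have h1 := (hlim 0).pos_mul_atTop hL ht
    have h2 := Filter.tendsto_atTop_add_const_right _ (h 0) h1
    refine h2.congr' ?_
    filter_upwards [ht.eventually_gt_atTop 0] with k hk
    rw [div_mul_cancel₀ _ hk.ne']
    simp
  rw [EReal.eq_top_iff_forall_lt]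
  intro R
  have ha : ∀ i, ∃ a : 𝒜, R + 1 ≤ ℓ (S.twin (z i).1.1 a) (z i).2 := fun i => by
    -- The margin `L * (|C| * r)` pays for replacing the ideal sensitive vector by a point of `𝒜`
    -- within `r`.
    obtain ⟨k, hk⟩ := (htop.eventually_ge_atTop (R + 1 + L * (|C| * r))).exists
    have hσ1 := hσ _ (z i).2.2
    have hσ0 : σ (z i).2 ≠ 0 := fun h0 => by simp [h0] at hσ1
    set e := projX (S.semiLatentInvᵀ *ᵥ θ) ⬝ᵥ projX (S.semiLatent (z i).1.1) with he
    -- Solves `b + σ * (p ⬝ᵥ (s • p) + e) = t k`.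
    set s := ((t k - b (z i).2) / σ (z i).2 - e) / (p ⬝ᵥ p) with hs
    obtain ⟨a, ha, hdist⟩ := hr (s • p)
    refine ⟨⟨a, ha⟩, ?_⟩
    rw [hℓ, dotProduct_twin]
    have h1 := hLip (b (z i).2 + σ (z i).2 * (p ⬝ᵥ a + e)) (t k)
    have h2 : t k - (b (z i).2 + σ (z i).2 * (p ⬝ᵥ a + e)) = σ (z i).2 * (p ⬝ᵥ (s • p - a)) := by
      rw [dotProduct_sub, dotProduct_smul, hs, smul_eq_mul]
      field_simp
      ring
    have h3 : |p ⬝ᵥ (s • p - a)| ≤ |C| * r := by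
      refine (hC _).trans ?_
      rw [← dist_eq_norm]
      exact mul_le_mul (le_abs_self C) hdist dist_nonneg (abs_nonneg C)
    rw [h2, abs_mul, hσ1, one_mul] at h1
    have h4 := (le_abs_self _).trans (h1.trans (mul_le_mul_of_nonneg_left h3 hL.le))
    change _ ≤ h (b (z i).2 + σ (z i).2 * (p ⬝ᵥ a + e))
    linarith
  choose a ha using ha
  refine lt_of_lt_of_le (EReal.coe_lt_coe_iff.2 (lt_add_one R)) (le_trans
    (EReal.coe_le_coe_iff.2 ?_) (twin_le_worstRisk hN hδ hℓ a))
  have hN' : (0 : ℝ) < N := by exact_mod_cast hN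
  rw [le_inv_mul_iff₀ hN']
  calc (N : ℝ) * (R + 1) = ∑ _i : Fin N, (R + 1) := by simp [mul_add]
    _ ≤ _ := Finset.sum_le_sum fun i _ => ha i

end WorstRisk

/-! ### The main theorem -/

theorem theorem3 {α χ : Type*} [Fintype α] [Fintype χ] [DecidableEq α] [DecidableEq χ]
    (S : LinearSCM (α ⊕ χ))
    (nrm : Seminorm ℝ (χ → ℝ)) (hnrm : ∀ x, nrm x = 0 → x = 0)
    (𝒜 : Set (α → ℝ)) (𝒴 : Set ℝ)
    {N : ℕ} (hN : 0 < N) (z : Fin N → ObsSpace χ 𝒜 𝒴)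
    (δ : ℝ) (hδ : 0 ≤ δ) (θ : α ⊕ χ → ℝ)
    (h : ℝ → ℝ) (L : ℝ)
    (hLip : ∀ t₁ t₂ : ℝ, |h t₂ - h t₁| ≤ L * |t₂ - t₁|)
    (hSlope : ∃ t : ℕ → ℝ, Filter.Tendsto (fun k => |t k|) Filter.atTop Filter.atTop ∧
      ∀ t₀ : ℝ, Filter.Tendsto (fun k => (h (t₀ + t k) - h t₀) / |t k|) Filter.atTop (nhds L))
    (ℓ : (α ⊕ χ → ℝ) → ℝ → ℝ)
    (hℓ : ℓ = regressionLoss h θ ∨ (ℓ = classificationLoss h θ ∧ 𝒴 ⊆ {-1, 1})) :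
    (Bornology.IsBounded 𝒜 →
      worstRisk S nrm 1 δ ℓ (empirical z) = cfRisk S ℓ (empirical z)
        + ((δ * L * dualNorm nrm (projX (S.semiLatentInvᵀ *ᵥ θ)) : ℝ) : EReal)) ∧
    (¬ Bornology.IsBounded 𝒜 →
      (projA (S.semiLatentInvᵀ *ᵥ θ) = 0 →
        worstRisk S nrm 1 δ ℓ (empirical z) = risk ℓ (empirical z)
          + ((δ * L * dualNorm nrm (projX (S.semiLatentInvᵀ *ᵥ θ)) : ℝ) : EReal)) ∧
      (projA (S.semiLatentInvᵀ *ᵥ θ) ≠ 0 → 0 < L →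
        (∃ r : ℝ, ∀ a : α → ℝ, ∃ a' ∈ 𝒜, dist a a' ≤ r) →
        worstRisk S nrm 1 δ ℓ (empirical z) = ⊤)) := by
  -- Both losses apply `h` to an affine function of the score whose slope is `±1` on the labels.
  obtain ⟨b, σ, hb, hσm, hℓ', hσ⟩ : ∃ b σ : ℝ → ℝ, Measurable b ∧ Measurable σ ∧
      (∀ v y, ℓ v y = h (b y + σ y * (θ ⬝ᵥ v))) ∧ ∀ y ∈ 𝒴, |σ y| = 1 := by
    rcases hℓ with rfl | ⟨rfl, h𝒴⟩
    · exact ⟨id, fun _ => -1, measurable_id, measurable_const,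
        fun v y => by simp [regressionLoss, sub_eq_add_neg], by simp⟩
    · refine ⟨fun _ => 0, id, measurable_const, measurable_id,
        fun v y => by simp [classificationLoss], fun y hy => ?_⟩
      rcases h𝒴 hy with rfl | rfl <;> simp
  refine ⟨fun hbdd => ?_, fun _ => ⟨fun hp => ?_, fun hp hL hr =>
    worstRisk_eq_top hN hδ hL hLip hSlope hℓ' hσ hp hr⟩⟩
  · have hL : 0 ≤ L := by simpa using (abs_nonneg _).trans (hLip 0 1)
    have hhc : LipschitzWith ⟨L, hL⟩ h := LipschitzWith.of_dist_le_mul fun x y => by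
      rw [dist_comm x, dist_comm (h x), Real.dist_eq, Real.dist_eq]
      exact hLip x y
    have hlub : ∀ z : ObsSpace χ 𝒜 𝒴, IsLUB ((fun a => ℓ (S.twin z.1.1 a) z.2) '' 𝒜)
        -- A bounded `𝒜` has compact closure, on which the loss of the twins is continuous, hence
        -- bounded.
        (sSup ((fun a => ℓ (S.twin z.1.1 a) z.2) '' 𝒜)) := fun z => by
      refine isLUB_csSup ⟨_, _, z.1.2, rfl⟩ ?_
      have hcont : Continuous fun a => ℓ (S.twin z.1.1 a) z.2 := by
        simp only [hℓ', dotProduct_twin]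
        have hc := hhc.continuous
        unfold dotProduct
        fun_prop
      exact ((hbdd.isCompact_closure.image hcont).bddAbove).mono
        (Set.image_mono subset_closure)
    rw [worstRisk_eq_of_isLUB hnrm hN hδ hLip hSlope hb hσm hℓ' hσ hlub, cfRisk]
    simp only [EReal.iSup_coe_eq_of_isLUB (hlub _)]
  · refine worstRisk_eq_of_isLUB hnrm hN hδ hLip hSlope hb hσm hℓ' hσ fun w => ?_
    have hconst : ∀ a, ℓ (S.twin w.1.1 a) w.2 = ℓ w.1.1 w.2 := fun a => by
      conv_rhs => rw [← S.twin_projA w.1.1]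
      rw [hℓ', hℓ', dotProduct_twin, dotProduct_twin, hp, zero_dotProduct, zero_dotProduct]
    simp only [hconst]
    rw [Set.Nonempty.image_const ⟨_, w.1.2⟩]
    exact isLUB_singleton
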